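/- Let $n \ge 1$, $t \in (0,1]$, and let $X_n, Y_n$ be independent $n\times n$ GUE matrices, normalised so that the density is proportional to $e^{-\mathrm{Tr}(X^2)/2}$ on Hermitian matrices (the diagonal entries are standard real Gaussian variables, the entries above the diagonal are centred complex Gaussian with independent real and imaginary parts of variance $1/2$, all of these being independent). Let $A_{n,t}$ be a random matrix with the law of $\sqrt{\tfrac{1+t}{2}}\,X_n + i\sqrt{\tfrac{1-t}{2}}\,Y_n$ (the Elliptic Ginibre Ensemble), and for $|z|<1$ put $$f_{n,t}(z) = \det\Big((1+tz^2)I_n - \tfrac{z}{\sqrt n}A_{n,t}\Big)\,e^{-\frac{n t z^2}{2}}.$$ Let $\mathrm{He}_k$ ($k \ge 0$) be the (probabilists') Hermite polynomials, i.e. the monic orthogonal polynomials with respect to $e^{-x^2/2}\,dx$ on $\mathbb{R}$, and for $z \neq 0$ let $g_t(z) = \tfrac1z + tz$. Then for every $z\in\mathbb{C}$ with $0<|z|<1$, the variable $|f_{n,t}(z)|^2$ is integrable and $$\mathbb{E}\big[|f_{n,t}(z)|^2\big] = \frac{n!\,|z|^{2n}}{n^n}\,\big|e^{-ntz^2}\big|\,\sum_{k=0}^{n}\frac{t^k}{k!}\,\Big|\mathrm{He}_k\Big(\sqrt{\tfrac{n}{t}}\;g_t(z)\Big)\Big|^2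 .$$ -/

import Mathlib

open MeasureTheory ProbabilityTheory

namespace EllipticGinibre

noncomputable section

/-- Matrices carry the product sigma-algebra of their entries. -/
instance matrixMeasurableSpace (n : ℕ) : MeasurableSpace (Matrix (Fin n) (Fin n) ℂ) :=
  (inferInstance : MeasurableSpace (Fin n → Fin n → ℂ))

/-- The Hermitian matrix built from real parameters: `g (i, i)` on the diagonal,
`(g (i, j) + I * g (j, i)) / √2` above the diagonal, and the conjugate below it. -/
def hermitianOfReal (n : ℕ) (g : Fin n × Fin n → ℝ) : Matrix (Fin n) (Fin n) ℂ :=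
  Matrix.of fun i j =>
    if i = j then (g (i, i) : ℂ)
    else if i < j then ((g (i, j) : ℂ) + Complex.I * (g (j, i) : ℂ)) / (Real.sqrt 2 : ℂ)
    else ((g (j, i) : ℂ) - Complex.I * (g (i, j) : ℂ)) / (Real.sqrt 2 : ℂ)

/-- The law of the Gaussian Unitary Ensemble of size `n`, with density proportional to
`exp (-Tr (X ^ 2) / 2)` on Hermitian matrices: the diagonal entries are standard real Gaussian,
the entries above the diagonal are standard complex Gaussian (`E |X i j| ^ 2 = 1`), all of these
independent. -/
def gueLaw (n : ℕ) : Measure (Matrix (Fin n) (Fin n) ℂ) :=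
  (Measure.pi fun _ : Fin n × Fin n => gaussianReal 0 1).map (hermitianOfReal n)

/-- The combination `√((1 + t) / 2) X + i √((1 - t) / 2) Y`. -/
def ellipticCombination (n : ℕ) (t : ℝ)
    (XY : Matrix (Fin n) (Fin n) ℂ × Matrix (Fin n) (Fin n) ℂ) : Matrix (Fin n) (Fin n) ℂ :=
  (Real.sqrt ((1 + t) / 2) : ℂ) • XY.1 + (Complex.I * (Real.sqrt ((1 - t) / 2) : ℂ)) • XY.2

/-- The law of the Elliptic Ginibre Ensemble of size `n` with parameter `t`: the law of
`√((1 + t) / 2) X + i √((1 - t) / 2) Y` for independent GUE matrices `X`, `Y` of size `n`. -/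
def ellipticGinibreLaw (n : ℕ) (t : ℝ) : Measure (Matrix (Fin n) (Fin n) ℂ) :=
  ((gueLaw n).prod (gueLaw n)).map (ellipticCombination n t)

/-- The normalised characteristic polynomial
`det (1 + t z ^ 2 - (z / √n) A) * exp (-n t z ^ 2 / 2)` of a matrix `A`. -/
def normalisedCharpoly (n : ℕ) (t : ℝ) (A : Matrix (Fin n) (Fin n) ℂ) (z : ℂ) : ℂ :=
  ((1 + (t : ℂ) * z ^ 2) • (1 : Matrix (Fin n) (Fin n) ℂ)
      - (z / (Real.sqrt (n : ℝ) : ℂ)) • A).det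
    * Complex.exp (-((n : ℂ) * (t : ℂ) * z ^ 2) / 2)

/-- The map `z ↦ 1 / z + t z`. -/
def g (t : ℝ) (z : ℂ) : ℂ := z⁻¹ + (t : ℂ) * z

theorem measurable_hermitianOfReal (n : ℕ) : Measurable (hermitianOfReal n) := by
  refine measurable_pi_lambda _ fun i => measurable_pi_lambda _ fun j => ?_
  simp only [hermitianOfReal, Matrix.of_apply]
  split_ifs <;> fun_prop

theorem measurable_ellipticCombination (n : ℕ) (t : ℝ) :
    Measurable (ellipticCombination n t) := by
  refine measurable_pi_lambda _ fun i => measurable_pi_lambda _ fun j => ?_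
  have h1 : Measurable fun XY : Matrix (Fin n) (Fin n) ℂ × Matrix (Fin n) (Fin n) ℂ =>
      XY.1 i j := (measurable_pi_apply j).comp ((measurable_pi_apply i).comp measurable_fst)
  have h2 : Measurable fun XY : Matrix (Fin n) (Fin n) ℂ × Matrix (Fin n) (Fin n) ℂ =>
      XY.2 i j := (measurable_pi_apply j).comp ((measurable_pi_apply i).comp measurable_snd)
  simp only [ellipticCombination, Matrix.add_apply, Matrix.smul_apply, smul_eq_mul]
  exact (h1.const_mul _).add (h2.const_mul _)

instance isProbabilityMeasure_gueLaw (n : ℕ) : IsProbabilityMeasure (gueLaw n) :=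
  Measure.isProbabilityMeasure_map (measurable_hermitianOfReal n).aemeasurable

instance isProbabilityMeasure_ellipticGinibreLaw (n : ℕ) (t : ℝ) :
    IsProbabilityMeasure (ellipticGinibreLaw n t) :=
  Measure.isProbabilityMeasure_map (measurable_ellipticCombination n t).aemeasurable

end

end EllipticGinibre

namespace EllipticGinibre

open scoped ComplexConjugate

/-! With `w = √n * g t z`, the normalised polynomial is an explicit scalar times `det (w - A)`, so
only the second moment of the latter is needed. It comes from Parseval's identity in an orthonormal
family of Wick products.

The law of `A` splits into independent units: a diagonal entry, or a transposed pair `(A i j, A j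
i)`. On an off-diagonal unit the functions `1`, `A i j`, `A j i`, `A i j * A j i - t` are
orthonormal, on a diagonal one `1` and `A i i` are; products of these over units are therefore
orthonormal (`integral_wickProd`).

In the Leibniz monomial of `σ`, write each 2-cycle as `A i j * A j i = (A i j * A j i - t) + t` and
each fixed point as `-A i i + w`. Expanding chooses a set `R` carrying the Wick factors; off `R`,
`σ` is an involution with only scalar weights. Summing over the involutions gives, as coefficient of
the Wick product of `(R, π)` with `π` a permutation of `R`, up to sign the matching polynomial of a
complete graph on `k = n - |R|` vertices, that is `√t ^ k * He_k (w / √t)`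
(`det_sub_eq_sum_wickProd`, `involutionSum_eq_hermite`). There are `n.choose k * (n - k)! = n! / k!`
pairs `(R, π)` for each `k`, which yields the formula. -/

/-! ### Gaussian moments up to order four -/

theorem integrable_pow_gaussian (k : ℕ) :
    Integrable (fun x : ℝ => x ^ k) (gaussianReal 0 1) := by
  have h := (memLp_id_gaussianReal (μ := 0) (v := 1) (k : NNReal)).integrable_norm_pow'
  refine (integrable_norm_iff (by fun_prop)).1 ?_
  simpa using h

theorem integral_pow_gaussian_eq_iteratedDeriv (k : ℕ) :
    ∫ x, x ^ k ∂(gaussianReal 0 1) = iteratedDeriv k (fun t : ℝ => Real.exp (t ^ 2 / 2)) 0 := by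
  have h := iteratedDeriv_mgf_zero (X := id) (μ := gaussianReal 0 1) (by simp) k
  rw [mgf_id_gaussianReal] at h
  simpa using h.symm

theorem integral_pow_two_gaussian : ∫ x, x ^ 2 ∂(gaussianReal 0 1) = 1 := by
  have h := variance_fun_id_gaussianReal (μ := 0) (v := 1)
  rw [variance_eq_integral (by fun_prop)] at h
  simpa using h

/-- Differentiation acts on the prefactor of the Gaussian moment generating function by `p ↦ p' + t
* p`; iterating it and evaluating at `0` gives the moments. -/
theorem deriv_polynomial_mul_exp (p p' : ℝ → ℝ) (hp : ∀ x, HasDerivAt p (p' x) x) :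
    deriv (fun t : ℝ => p t * Real.exp (t ^ 2 / 2)) =
      fun t => (p' t + t * p t) * Real.exp (t ^ 2 / 2) := by
  ext x
  have h1 : HasDerivAt (fun t : ℝ => Real.exp (t ^ 2 / 2)) (Real.exp (x ^ 2 / 2) * x) x := by
    have := ((hasDerivAt_pow 2 x).div_const 2).exp
    convert this using 1
    simp
  rw [((hp x).fun_mul h1).deriv]
  ring

theorem iteratedDeriv_gaussian_one :
    iteratedDeriv 1 (fun t : ℝ => Real.exp (t ^ 2 / 2)) =
      fun t => t * Real.exp (t ^ 2 / 2) := by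
  rw [iteratedDeriv_one]
  have h := deriv_polynomial_mul_exp (fun _ => 1) (fun _ => 0) (fun x => hasDerivAt_const x 1)
  simpa using h

theorem iteratedDeriv_gaussian_two :
    iteratedDeriv 2 (fun t : ℝ => Real.exp (t ^ 2 / 2)) =
      fun t => (1 + t ^ 2) * Real.exp (t ^ 2 / 2) := by
  rw [iteratedDeriv_succ, iteratedDeriv_gaussian_one,
    deriv_polynomial_mul_exp (fun x => x) (fun _ => 1) (fun x => hasDerivAt_id x)]
  ext x
  ring

theorem iteratedDeriv_gaussian_three :
    iteratedDeriv 3 (fun t : ℝ => Real.exp (t ^ 2 / 2)) =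
      fun t => (3 * t + t ^ 3) * Real.exp (t ^ 2 / 2) := by
  rw [iteratedDeriv_succ, iteratedDeriv_gaussian_two,
    deriv_polynomial_mul_exp (fun x => 1 + x ^ 2) (fun x => 2 * x)
      (fun x => by simpa using (hasDerivAt_pow 2 x).const_add 1)]
  ext x
  ring

theorem iteratedDeriv_gaussian_four :
    iteratedDeriv 4 (fun t : ℝ => Real.exp (t ^ 2 / 2)) =
      fun t => (3 + 6 * t ^ 2 + t ^ 4) * Real.exp (t ^ 2 / 2) := by
  rw [iteratedDeriv_succ, iteratedDeriv_gaussian_three,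
    deriv_polynomial_mul_exp (fun x => 3 * x + x ^ 3) (fun x => 3 + 3 * x ^ 2)
      (fun x => by simpa using ((hasDerivAt_id x).const_mul 3).fun_add (hasDerivAt_pow 3 x))]
  ext x
  ring

theorem integral_pow_three_gaussian : ∫ x, x ^ 3 ∂(gaussianReal 0 1) = 0 := by
  simp [integral_pow_gaussian_eq_iteratedDeriv, iteratedDeriv_gaussian_three]

theorem integral_pow_four_gaussian : ∫ x, x ^ 4 ∂(gaussianReal 0 1) = 3 := by
  simp [integral_pow_gaussian_eq_iteratedDeriv, iteratedDeriv_gaussian_four]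

/-- The moments of order at most four of a standard real Gaussian variable. -/
theorem integral_pow_gaussian (k : Fin 5) :
    ∫ x, ((x : ℝ) : ℂ) ^ (k : ℕ) ∂(gaussianReal 0 1) = ![1, 0, 1, 0, 3] k := by
  have h : ∀ m : ℕ, ∫ x, ((x : ℝ) : ℂ) ^ m ∂(gaussianReal 0 1) =
      ((∫ x, x ^ m ∂(gaussianReal 0 1) : ℝ) : ℂ) := fun m => by
    rw [← integral_complex_ofReal]; simp
  fin_cases k
  · simp
  · have := h 1
    simp only [pow_one, integral_id_gaussianReal] at this
    simpa using this
  · simpa [integral_pow_two_gaussian] using h 2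
  · simpa [integral_pow_three_gaussian] using h 3
  · simpa [integral_pow_four_gaussian] using h 4

/-! ### Inner products of functions of two independent variables -/

/-- The function of two variables with coefficients `c` in the products of the functions `u i`. -/
noncomputable def tensorSum {X : Type*} (u : Fin 3 → X → ℂ) (c : Fin 3 → Fin 3 → ℂ)
    (x : X × X) : ℂ :=
  ∑ i, ∑ j, c i j * (u i x.1 * u j x.2)

theorem tensorSum_mul_conj {X : Type*} (u : Fin 3 → X → ℂ) (c d : Fin 3 → Fin 3 → ℂ)
    (x : X × X) :
    tensorSum u c x * conj (tensorSum u d x) = ∑ i, ∑ j, ∑ k, ∑ l, c i j * conj (d k l) *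
      ((u i x.1 * conj (u k x.1)) * (u j x.2 * conj (u l x.2))) := by
  simp only [tensorSum, map_sum, map_mul, Finset.sum_mul]
  simp only [Finset.mul_sum]
  exact Finset.sum_congr rfl fun i _ => Finset.sum_congr rfl fun j _ =>
    Finset.sum_congr rfl fun k _ => Finset.sum_congr rfl fun l _ => by ring

theorem integrable_tensorSum {X : Type*} [MeasurableSpace X] (μ : Measure X) [SFinite μ]
    (u : Fin 3 → X → ℂ) (hu : ∀ i j, Integrable (fun x => u i x * conj (u j x)) μ)
    (c d : Fin 3 → Fin 3 → ℂ) :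
    Integrable (fun x => tensorSum u c x * conj (tensorSum u d x)) (μ.prod μ) := by
  simp only [tensorSum_mul_conj]
  exact integrable_finsetSum _ fun i _ => integrable_finsetSum _ fun j _ =>
    integrable_finsetSum _ fun k _ => integrable_finsetSum _ fun l _ =>
      ((hu i k).mul_prod (hu j l)).const_mul _

/-- By Fubini the Gram matrix of the products is the tensor square of the Gram matrix of `u`. It
serves twice: for monomials in real Gaussians, and for `orthoPoly`, whose Gram matrix is the
identity. -/
theorem integral_tensorSum {X : Type*} [MeasurableSpace X] (μ : Measure X) [SFinite μ]
    (u : Fin 3 → X → ℂ) (hu : ∀ i j, Integrable (fun x => u i x * conj (u j x)) μ)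
    (c d : Fin 3 → Fin 3 → ℂ) :
    ∫ x, tensorSum u c x * conj (tensorSum u d x) ∂(μ.prod μ) =
      ∑ i, ∑ j, ∑ k, ∑ l, c i j * conj (d k l) *
        ((∫ x, u i x * conj (u k x) ∂μ) * ∫ x, u j x * conj (u l x) ∂μ) := by
  have h : ∀ i j k l, Integrable (fun x : X × X => c i j * conj (d k l) *
      ((u i x.1 * conj (u k x.1)) * (u j x.2 * conj (u l x.2)))) (μ.prod μ) := fun i j k l =>
    ((hu i k).mul_prod (hu j l)).const_mul _
  simp only [tensorSum_mul_conj]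
  rw [integral_finsetSum _ fun i _ => integrable_finsetSum _ fun j _ =>
    integrable_finsetSum _ fun k _ => integrable_finsetSum _ fun l _ => h i j k l]
  refine Finset.sum_congr rfl fun i _ => ?_
  rw [integral_finsetSum _ fun j _ =>
    integrable_finsetSum _ fun k _ => integrable_finsetSum _ fun l _ => h i j k l]
  refine Finset.sum_congr rfl fun j _ => ?_
  rw [integral_finsetSum _ fun k _ => integrable_finsetSum _ fun l _ => h i j k l]
  refine Finset.sum_congr rfl fun k _ => ?_
  rw [integral_finsetSum _ fun l _ => h i j k l]
  refine Finset.sum_congr rfl fun l _ => ?_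
  rw [integral_const_mul]
  congr 1
  exact integral_prod_mul (fun x => u i x * conj (u k x)) (fun x => u j x * conj (u l x))

/-! ### The scalar elliptic Gaussian and its orthonormal polynomials -/

/-- The law of `√((1 + t) / 2) x + i √((1 - t) / 2) y` for independent standard real
Gaussian variables `x`, `y`. -/
noncomputable def scalarLaw (t : ℝ) : Measure ℂ :=
  ((gaussianReal 0 1).prod (gaussianReal 0 1)).map fun x : ℝ × ℝ =>
    (Real.sqrt ((1 + t) / 2) : ℂ) * (x.1 : ℂ) +
      Complex.I * (Real.sqrt ((1 - t) / 2) : ℂ) * (x.2 : ℂ)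

instance isProbabilityMeasure_scalarLaw (t : ℝ) : IsProbabilityMeasure (scalarLaw t) :=
  Measure.isProbabilityMeasure_map (by fun_prop)

/-- The orthonormal polynomials of degree at most two for `scalarLaw t`. -/
noncomputable def orthoPoly (t : ℝ) : Fin 3 → ℂ → ℂ :=
  ![fun _ => 1, fun p => p, fun p => (p ^ 2 - t) / (Real.sqrt 2 : ℂ)]

theorem continuous_orthoPoly (t : ℝ) (i : Fin 3) : Continuous (orthoPoly t i) := by
  fin_cases i <;> simp [orthoPoly] <;> fun_prop

/-- The coefficients of `orthoPoly t` in the two Gaussian variables. -/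
noncomputable def orthoPolyCoeff (t : ℝ) : Fin 3 → Fin 3 → Fin 3 → ℂ :=
  ![![![1, 0, 0], ![0, 0, 0], ![0, 0, 0]],
    ![![0, Complex.I * (Real.sqrt ((1 - t) / 2) : ℂ), 0],
      ![(Real.sqrt ((1 + t) / 2) : ℂ), 0, 0], ![0, 0, 0]],
    ![![-t / (Real.sqrt 2 : ℂ), 0, - (Real.sqrt ((1 - t) / 2) : ℂ) ^ 2 / (Real.sqrt 2 : ℂ)],
      ![0, 2 * Complex.I * (Real.sqrt ((1 - t) / 2) : ℂ) * (Real.sqrt ((1 + t) / 2) : ℂ)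
        / (Real.sqrt 2 : ℂ), 0],
      ![(Real.sqrt ((1 + t) / 2) : ℂ) ^ 2 / (Real.sqrt 2 : ℂ), 0, 0]]]

theorem orthoPoly_eq_tensorSum (t : ℝ) (k : Fin 3) (x : ℝ × ℝ) :
    orthoPoly t k ((Real.sqrt ((1 + t) / 2) : ℂ) * (x.1 : ℂ) +
      Complex.I * (Real.sqrt ((1 - t) / 2) : ℂ) * (x.2 : ℂ)) =
    tensorSum (fun i x => ((x : ℝ) : ℂ) ^ (i : ℕ)) (orthoPolyCoeff t k) x := by
  fin_cases k
  · simp [tensorSum, Fin.sum_univ_three, orthoPoly, orthoPolyCoeff]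
  · simp [tensorSum, Fin.sum_univ_three, orthoPoly, orthoPolyCoeff]
    ring
  · simp [tensorSum, Fin.sum_univ_three, orthoPoly, orthoPolyCoeff]
    ring_nf
    simp
    ring

theorem integrable_pow_mul_conj_gaussian (i j : Fin 3) :
    Integrable (fun x : ℝ => (x : ℂ) ^ (i : ℕ) * conj ((x : ℂ) ^ (j : ℕ)))
      (gaussianReal 0 1) := by
  have := (integrable_pow_gaussian (i + j)).ofReal (𝕜 := ℂ)
  simpa [pow_add] using this

theorem integral_pow_mul_conj_gaussian (i j : Fin 3) :
    ∫ x : ℝ, (x : ℂ) ^ (i : ℕ) * conj ((x : ℂ) ^ (j : ℕ)) ∂(gaussianReal 0 1) =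
      ![![1, 0, 1], ![0, 1, 0], ![1, 0, 3]] i j := by
  have h := integral_pow_gaussian ⟨i + j, by omega⟩
  simp only [pow_add] at h
  simp only [map_pow, Complex.conj_ofReal]
  rw [h]
  fin_cases i <;> fin_cases j <;> rfl

theorem integrable_orthoPoly (t : ℝ) (i j : Fin 3) :
    Integrable (fun p => orthoPoly t i p * conj (orthoPoly t j p)) (scalarLaw t) := by
  have hc := continuous_orthoPoly t
  rw [scalarLaw, integrable_map_measure (by fun_prop) (by fun_prop)]
  simp only [Function.comp_def, orthoPoly_eq_tensorSum]
  exact integrable_tensorSum _ _ integrable_pow_mul_conj_gaussian _ _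

/-- The underlying moments are `E |p|² = 1`, `E p² = t` and `E |p|⁴ = 2 + t²`, so `p² - t` has
squared norm `2`. The bounds on `t` keep both radicands nonnegative. -/
theorem integral_orthoPoly {t : ℝ} (h0 : -1 ≤ t) (h1 : t ≤ 1) (i j : Fin 3) :
    ∫ p, orthoPoly t i p * conj (orthoPoly t j p) ∂(scalarLaw t) = if i = j then 1 else 0 := by
  have hc := continuous_orthoPoly t
  rw [scalarLaw, integral_map (by fun_prop) (by fun_prop)]
  simp only [orthoPoly_eq_tensorSum]
  rw [integral_tensorSum _ _ integrable_pow_mul_conj_gaussian]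
  simp only [integral_pow_mul_conj_gaussian]
  have ha : (Real.sqrt ((1 + t) / 2) : ℂ) ^ 2 = (1 + t) / 2 := by
    rw [← Complex.ofReal_pow, Real.sq_sqrt (by linarith)]; simp
  have hb : (Real.sqrt ((1 - t) / 2) : ℂ) ^ 2 = (1 - t) / 2 := by
    rw [← Complex.ofReal_pow, Real.sq_sqrt (by linarith)]; simp
  have hs : (Real.sqrt 2 : ℂ) ^ 2 = 2 := by
    rw [← Complex.ofReal_pow, Real.sq_sqrt (by norm_num)]; simp
  have hs0 : (Real.sqrt 2 : ℂ) ≠ 0 := by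
    intro h; rw [h] at hs; norm_num at hs
  simp only [Fin.sum_univ_three, orthoPolyCoeff]
  generalize (Real.sqrt ((1 + t) / 2) : ℝ) = a at ha
  generalize (Real.sqrt ((1 - t) / 2) : ℝ) = b at hb
  generalize (Real.sqrt 2 : ℝ) = s at hs hs0
  have hI := Complex.I_sq
  have h2 : conj (2 : ℂ) = 2 := Complex.conj_ofNat 2
  fin_cases i <;> fin_cases j <;> simp <;> (try field_simp) <;> simp [ha, hb, hI, hs, h2] <;>
    try ring_nf

/-! ### The ensemble as a function of independent pairs -/

/-- The hermitian-type matrix built from independent pairs of complex numbers. -/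
noncomputable def matrixOfPairs (n : ℕ) (Z : Fin n × Fin n → ℂ × ℂ) :
    Matrix (Fin n) (Fin n) ℂ :=
  Matrix.of fun i j =>
    if i = j then (Z (i, i)).1
    else if i < j then ((Z (i, j)).1 + Complex.I * (Z (i, j)).2) / (Real.sqrt 2 : ℂ)
    else ((Z (j, i)).1 - Complex.I * (Z (j, i)).2) / (Real.sqrt 2 : ℂ)

theorem measurable_matrixOfPairs (n : ℕ) : Measurable (matrixOfPairs n) := by
  refine measurable_pi_lambda _ fun i => measurable_pi_lambda _ fun j => ?_
  simp only [matrixOfPairs, Matrix.of_apply]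
  split_ifs <;> fun_prop

/-- Selects one coordinate for each edge from independent pairs indexed by the edges. -/
def edgeSelect (n : ℕ) (Z : Fin n × Fin n → ℂ × ℂ) (e : Fin n × Fin n) : ℂ :=
  if e.1 ≤ e.2 then (Z e).1 else (Z e.swap).2

theorem measurable_edgeSelect (n : ℕ) : Measurable (edgeSelect n) := by
  refine measurable_pi_lambda _ fun e => ?_
  simp only [edgeSelect]
  split_ifs <;> fun_prop

/-- An injective choice of coordinates from an i.i.d. family is i.i.d. This regroups the parameters
so that transposed entries share one pair; the coordinates not chosen are harmless padding. -/
theorem map_edgeSelect (n : ℕ) (ν : Measure ℂ) [IsProbabilityMeasure ν] :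
    (Measure.pi fun _ : Fin n × Fin n => ν.prod ν).map (edgeSelect n) =
      Measure.pi fun _ : Fin n × Fin n => ν := by
  have hsel := measurable_edgeSelect n
  have h1 := (measurePreserving_arrowProdEquivProdArrow ℂ ℂ (Fin n × Fin n)
    (fun _ => ν) (fun _ => ν)).symm
  have h2 := measurePreserving_sumPiEquivProdPi (ι := Fin n × Fin n) (ι' := Fin n × Fin n)
    (X := fun _ => ℂ) (fun _ => ν)
  have h3 : iIndepFun (fun (s : (Fin n × Fin n) ⊕ (Fin n × Fin n))
      (ω : (Fin n × Fin n) ⊕ (Fin n × Fin n) → ℂ) => ω s) (Measure.pi fun _ => ν) :=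
    iIndepFun_pi (X := fun _ => id) (fun _ => aemeasurable_id)
  let s : Fin n × Fin n → (Fin n × Fin n) ⊕ (Fin n × Fin n) := fun e =>
    if e.1 ≤ e.2 then Sum.inl e else Sum.inr e.swap
  have hs : Function.Injective s := by
    intro e f h
    simp only [s] at h
    split_ifs at h
    · exact Sum.inl_injective h
    · exact Prod.swap_injective (Sum.inr_injective h)
  have h4 := (iIndepFun_iff_map_fun_eq_pi_map fun i => (measurable_pi_apply _).aemeasurable).1
    (h3.precomp hs)
  have h5 : ∀ e, (Measure.pi fun _ : (Fin n × Fin n) ⊕ (Fin n × Fin n) => ν).map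
      (fun ω => ω e) = ν := fun e => (measurePreserving_eval (fun _ => ν) e).map_eq
  simp only [h5] at h4
  rw [← h4, ← h1.map_eq, ← h2.map_eq, Measure.map_map, Measure.map_map]
  · congr 1
    funext ω e
    simp only [s, edgeSelect, Function.comp_apply]
    split_ifs <;> rfl
  · exact hsel.comp h1.measurable
  · exact h2.measurable
  · exact hsel
  · exact h1.measurable

/-- The family of complex combinations of two families of reals. -/
noncomputable def scalarCombination (n : ℕ) (t : ℝ)
    (x : (Fin n × Fin n → ℝ) × (Fin n × Fin n → ℝ)) (e : Fin n × Fin n) : ℂ :=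
  (Real.sqrt ((1 + t) / 2) : ℂ) * (x.1 e : ℂ) +
      Complex.I * (Real.sqrt ((1 - t) / 2) : ℂ) * (x.2 e : ℂ)

theorem map_scalarCombination (n : ℕ) (t : ℝ) :
    ((Measure.pi fun _ : Fin n × Fin n => gaussianReal 0 1).prod
      (Measure.pi fun _ : Fin n × Fin n => gaussianReal 0 1)).map (scalarCombination n t) =
      Measure.pi fun _ : Fin n × Fin n => scalarLaw t := by
  have h1 := measurePreserving_arrowProdEquivProdArrow ℝ ℝ (Fin n × Fin n)
    (fun _ => gaussianReal 0 1) (fun _ => gaussianReal 0 1)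
  rw [← h1.map_eq, Measure.map_map]
  · unfold scalarLaw
    rw [← Measure.pi_map_pi (fun _ => by fun_prop)]
    rfl
  · unfold scalarCombination; fun_prop
  · fun_prop

/-- `hermitianOfReal` extends to the complex-linear map `H`, which commutes with the elliptic
combination; the combination can thus be taken on the parameters. -/
theorem ellipticGinibreLaw_eq_map_matrixOfPairs (n : ℕ) (t : ℝ) :
    ellipticGinibreLaw n t =
      (Measure.pi fun _ : Fin n × Fin n => (scalarLaw t).prod (scalarLaw t)).map
        (matrixOfPairs n) := by
  let H : (Fin n × Fin n → ℂ) → Matrix (Fin n) (Fin n) ℂ := fun p => Matrix.of fun i j =>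
    if i = j then p (i, i)
    else if i < j then (p (i, j) + Complex.I * p (j, i)) / (Real.sqrt 2 : ℂ)
    else (p (j, i) - Complex.I * p (i, j)) / (Real.sqrt 2 : ℂ)
  have hH : Measurable H := by
    refine measurable_pi_lambda _ fun i => measurable_pi_lambda _ fun j => ?_
    simp only [H, Matrix.of_apply]
    split_ifs <;> fun_prop
  have hc : Measurable (scalarCombination n t) := by unfold scalarCombination; fun_prop
  have hsel := measurable_edgeSelect n
  have e1 : ellipticCombination n t ∘ Prod.map (hermitianOfReal n) (hermitianOfReal n) =
      H ∘ scalarCombination n t := by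
    funext x
    ext i j
    simp only [ellipticCombination, Function.comp_apply, Prod.map_fst, Prod.map_snd, hermitianOfReal,
      H,
      scalarCombination, Matrix.add_apply, Matrix.smul_apply, Matrix.of_apply, smul_eq_mul]
    split_ifs <;> ring
  have e2 : H ∘ edgeSelect n = matrixOfPairs n := by
    funext Z
    ext i j
    simp only [Function.comp_apply, H, edgeSelect, matrixOfPairs, Matrix.of_apply, Prod.swap]
    split_ifs <;> first | rfl | (exfalso; order)
  rw [ellipticGinibreLaw, gueLaw, Measure.map_prod_map _ _ (measurable_hermitianOfReal n)
    (measurable_hermitianOfReal n), Measure.map_map (measurable_ellipticCombination n t)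
      ((measurable_hermitianOfReal n).prodMap (measurable_hermitianOfReal n)), e1,
    ← Measure.map_map hH hc, map_scalarCombination, ← map_edgeSelect, Measure.map_map hH hsel, e2]

/-! ### Wick products and their orthonormality -/

/-- The orthonormal functions of a diagonal entry. -/
noncomputable def diagFactor (b : Bool) (x : ℂ) : ℂ := if b then x else 1

/-- The orthonormal functions of a pair of transposed entries. -/
noncomputable def pairFactor (t : ℝ) : Bool → Bool → ℂ → ℂ → ℂ
  | false, false, _, _ => 1
  | true, false, x, _ => x
  | false, true, _, y => y
  | true, true, x, y => x * y - t

/-- The factor of the Wick product over a set of edges `F` that belongs to the entries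
`(i, j)` and `(j, i)`. -/
noncomputable def unitFactor {n : ℕ} (t : ℝ) (F : Fin n × Fin n → Bool)
    (A : Matrix (Fin n) (Fin n) ℂ) (e : Fin n × Fin n) : ℂ :=
  if e.1 = e.2 then diagFactor (F e) (A e.1 e.1)
  else if e.1 < e.2 then pairFactor t (F e) (F e.swap) (A e.1 e.2) (A e.2 e.1)
  else 1

/-- The Wick product of the entries of `A` over a set of edges `F`. -/
noncomputable def wickProd {n : ℕ} (t : ℝ) (F : Fin n × Fin n → Bool)
    (A : Matrix (Fin n) (Fin n) ℂ) : ℂ :=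
  ∏ e, unitFactor t F A e

/-- The coefficients of `unitFactor` in the orthonormal polynomials. -/
noncomputable def unitCoeff {n : ℕ} (F : Fin n × Fin n → Bool) (e : Fin n × Fin n) :
    Fin 3 → Fin 3 → ℂ :=
  if e.1 = e.2 then
    (if F e then ![![0, 0, 0], ![1, 0, 0], ![0, 0, 0]] else ![![1, 0, 0], ![0, 0, 0], ![0, 0, 0]])
  else if e.1 < e.2 then
    match F e, F e.swap with
    | false, false => ![![1, 0, 0], ![0, 0, 0], ![0, 0, 0]]
    | true, false => ![![0, Complex.I / (Real.sqrt 2 : ℂ), 0],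
        ![1 / (Real.sqrt 2 : ℂ), 0, 0], ![0, 0, 0]]
    | false, true => ![![0, - Complex.I / (Real.sqrt 2 : ℂ), 0],
        ![1 / (Real.sqrt 2 : ℂ), 0, 0], ![0, 0, 0]]
    | true, true => ![![0, 0, 1 / (Real.sqrt 2 : ℂ)], ![0, 0, 0],
        ![1 / (Real.sqrt 2 : ℂ), 0, 0]]
  else ![![1, 0, 0], ![0, 0, 0], ![0, 0, 0]]

theorem ofReal_sqrt_two_sq : (Real.sqrt 2 : ℂ) ^ 2 = 2 := by
  rw [← Complex.ofReal_pow, Real.sq_sqrt (by norm_num)]; simp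

theorem ofReal_sqrt_two_ne_zero : (Real.sqrt 2 : ℂ) ≠ 0 := by
  intro h
  simpa [h] using ofReal_sqrt_two_sq

/-- The essential case is `A i j * A j i = (p² + q²) / 2`, so that subtracting `t` leaves `((p² - t)
+ (q² - t)) / 2`. -/
theorem unitFactor_matrixOfPairs {n : ℕ} (t : ℝ) (F : Fin n × Fin n → Bool)
    (Z : Fin n × Fin n → ℂ × ℂ) (e : Fin n × Fin n) :
    unitFactor t F (matrixOfPairs n Z) e = tensorSum (orthoPoly t) (unitCoeff F e) (Z e) := by
  have hs := ofReal_sqrt_two_sq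
  have hs0 := ofReal_sqrt_two_ne_zero
  obtain ⟨i, j⟩ := e
  rcases lt_trichotomy i j with h | h | h
  · have h' : i ≠ j := h.ne
    simp only [unitFactor, unitCoeff, matrixOfPairs, Matrix.of_apply, h, h', if_true, if_false,
      h'.symm, h.asymm]
    cases hF : F (i, j) <;> cases hG : F (Prod.swap (i, j)) <;>
      simp [pairFactor, tensorSum, orthoPoly, Fin.sum_univ_three]
    · ring
    · ring
    · field_simp
      rw [hs]
      ring_nf
      simp
  · subst h
    cases hF : F (i, i) <;> simp [unitFactor, unitCoeff, matrixOfPairs, hF, diagFactor,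
      tensorSum, orthoPoly, Fin.sum_univ_three]
  · simp [unitFactor, unitCoeff, h.ne', h.asymm, tensorSum, orthoPoly, Fin.sum_univ_three]

/-- Whether two sets of edges agree on the edges `(i, j)` and `(j, i)`, for `i ≤ j`. -/
def AgreeOn {n : ℕ} (F G : Fin n × Fin n → Bool) (e : Fin n × Fin n) : Prop :=
  e.1 ≤ e.2 → F e = G e ∧ F e.swap = G e.swap

-- Orthonormality within one unit, read on coefficient arrays. Units with `i > j` are trivial on
-- both sides: the factor is `1` and `AgreeOn` is vacuous.
open scoped Classical in
theorem sum_unitCoeff_mul_conj {n : ℕ} (F G : Fin n × Fin n → Bool) (e : Fin n × Fin n) :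
    ∑ i, ∑ j, unitCoeff F e i j * conj (unitCoeff G e i j) =
      if AgreeOn F G e then 1 else 0 := by
  have hs := ofReal_sqrt_two_sq
  have hs0 := ofReal_sqrt_two_ne_zero
  obtain ⟨i, j⟩ := e
  rcases lt_trichotomy i j with h | h | h
  · simp only [unitCoeff, h, h.ne, if_true, if_false, AgreeOn, h.le, true_imp_iff]
    cases F (i, j) <;> cases F (Prod.swap (i, j)) <;> cases G (i, j) <;>
      cases G (Prod.swap (i, j)) <;> simp [Fin.sum_univ_three] <;> field_simp <;>
      simp [hs] <;> norm_num
  · subst h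
    cases hF : F (i, i) <;> cases hG : G (i, i) <;> simp [unitCoeff, AgreeOn, hF, hG,
      Fin.sum_univ_three]
  · simp [unitCoeff, h.ne', h.asymm, AgreeOn, h.not_ge, Fin.sum_univ_three]

theorem forall_agreeOn_iff {n : ℕ} (F G : Fin n × Fin n → Bool) :
    (∀ e, AgreeOn F G e) ↔ F = G := by
  refine ⟨fun h => funext fun e => ?_, fun h e _ => by simp [h]⟩
  rcases le_total e.1 e.2 with he | he
  · exact (h e he).1
  · exact (h e.swap he).2

theorem measurable_wickProd {n : ℕ} (t : ℝ) (F : Fin n × Fin n → Bool) :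
    Measurable (wickProd t F) := by
  have h : ∀ i j : Fin n, Measurable fun A : Matrix (Fin n) (Fin n) ℂ => A i j := fun i j =>
    (measurable_pi_apply j).comp (measurable_pi_apply i)
  refine Finset.measurable_fun_prod _ fun e _ => ?_
  unfold unitFactor diagFactor
  cases F e <;> cases F e.swap <;> simp only [pairFactor] <;> split_ifs <;> fun_prop

theorem wickProd_mul_conj_matrixOfPairs {n : ℕ} (t : ℝ) (F G : Fin n × Fin n → Bool)
    (Z : Fin n × Fin n → ℂ × ℂ) :
    wickProd t F (matrixOfPairs n Z) * conj (wickProd t G (matrixOfPairs n Z)) =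
      ∏ e, tensorSum (orthoPoly t) (unitCoeff F e) (Z e) *
        conj (tensorSum (orthoPoly t) (unitCoeff G e) (Z e)) := by
  simp only [wickProd, map_prod, unitFactor_matrixOfPairs, Finset.prod_mul_distrib]

theorem integrable_wickProd {n : ℕ} (t : ℝ) (F G : Fin n × Fin n → Bool) :
    Integrable (fun A => wickProd t F A * conj (wickProd t G A)) (ellipticGinibreLaw n t) := by
  have h1 := measurable_wickProd t F
  have h2 := measurable_wickProd t G
  rw [ellipticGinibreLaw_eq_map_matrixOfPairs, integrable_map_measure
    (by fun_prop) (measurable_matrixOfPairs n).aemeasurable]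
  simp only [Function.comp_def, wickProd_mul_conj_matrixOfPairs]
  exact Integrable.fintype_prod (f := fun e z => tensorSum (orthoPoly t) (unitCoeff F e) z *
        conj (tensorSum (orthoPoly t) (unitCoeff G e) z)) fun e =>
    integrable_tensorSum _ _ (integrable_orthoPoly t) _ _

open scoped Classical in
/-- The Wick products over sets of edges are orthonormal. -/
theorem integral_wickProd {n : ℕ} {t : ℝ} (h0 : -1 ≤ t) (h1 : t ≤ 1)
    (F G : Fin n × Fin n → Bool) :
    ∫ A, wickProd t F A * conj (wickProd t G A) ∂(ellipticGinibreLaw n t) =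
      if F = G then 1 else 0 := by
  have hF := measurable_wickProd t F
  have hG := measurable_wickProd t G
  rw [ellipticGinibreLaw_eq_map_matrixOfPairs, integral_map
    (measurable_matrixOfPairs n).aemeasurable (by fun_prop)]
  simp only [wickProd_mul_conj_matrixOfPairs]
  rw [integral_fintype_prod_eq_prod (f := fun e z =>
    tensorSum (orthoPoly t) (unitCoeff F e) z * conj (tensorSum (orthoPoly t) (unitCoeff G e) z))]
  simp only [integral_tensorSum _ _ (integrable_orthoPoly t), integral_orthoPoly h0 h1]
  have h : ∀ e, (∑ i, ∑ j, ∑ k, ∑ l, unitCoeff F e i j * conj (unitCoeff G e k l) *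
      ((if i = k then (1 : ℂ) else 0) * if j = l then 1 else 0)) =
      if AgreeOn F G e then 1 else 0 := fun e => by
    rw [← sum_unitCoeff_mul_conj]
    simp
  simp only [h, Finset.prod_ite_zero, Finset.mem_univ, true_imp_iff, forall_agreeOn_iff,
    Finset.prod_const_one]

/-! ### Wick expansion of the monomial of a permutation -/

/-- A product over a set invariant under a permutation, with the factors of each orbit of
size two put together. -/
theorem prod_eq_prod_mul_prod_two_cycles {ι M : Type*} [LinearOrder ι] [CommMonoid M]
    (σ : Equiv.Perm ι) (S : Finset ι) (hS : ∀ i, σ i ∈ S ↔ i ∈ S) (f : ι → M) :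
    ∏ i ∈ S, f i = (∏ i ∈ S with σ (σ i) ≠ i, f i) *
      ∏ i ∈ S with i ≤ σ i ∧ σ (σ i) = i, (if σ i = i then f i else f i * f (σ i)) := by
  have h1 : ∏ i ∈ S with i ≤ σ i ∧ σ (σ i) = i, (if σ i = i then f i else f i * f (σ i)) =
      (∏ i ∈ S with i ≤ σ i ∧ σ (σ i) = i, f i) *
        ∏ i ∈ S with i < σ i ∧ σ (σ i) = i, f (σ i) := by
    rw [Finset.prod_filter, Finset.prod_filter, Finset.prod_filter, ← Finset.prod_mul_distrib]
    refine Finset.prod_congr rfl fun i _ => ?_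
    rcases eq_or_ne (σ i) i with h | h
    · simp [h]
    · by_cases h2 : i ≤ σ i <;> by_cases h3 : σ (σ i) = i <;>
        simp [h, h2, h3, lt_iff_le_and_ne, Ne.symm h]
  -- Reindexing by `σ` exchanges the smaller and the larger point of each 2-cycle.
  have h2 : ∏ i ∈ S with i < σ i ∧ σ (σ i) = i, f (σ i) =
      ∏ i ∈ S with σ i < i ∧ σ (σ i) = i, f i := by
    refine Finset.prod_nbij' σ σ ?_ ?_ ?_ ?_ ?_ <;>
      simp +contextual [hS]
  rw [h1, h2, Finset.prod_filter, Finset.prod_filter, Finset.prod_filter,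
    ← Finset.prod_mul_distrib, ← Finset.prod_mul_distrib]
  refine Finset.prod_congr rfl fun i _ => ?_
  by_cases h3 : σ (σ i) = i <;> rcases le_or_gt i (σ i) with h4 | h4 <;>
    simp [h3, h4, not_lt_of_ge, not_le_of_gt]

/-- The edges `(i, σ i)` with `i ∈ R`. -/
def permGraph {n : ℕ} (σ : Equiv.Perm (Fin n)) (R : Finset (Fin n)) (e : Fin n × Fin n) : Bool :=
  decide (e.1 ∈ R ∧ σ e.1 = e.2)

theorem wickProd_permGraph {n : ℕ} (t : ℝ) (σ : Equiv.Perm (Fin n)) (R : Finset (Fin n))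
    (hR : ∀ i, σ i ∈ R ↔ i ∈ R) (A : Matrix (Fin n) (Fin n) ℂ) :
    wickProd t (permGraph σ R) A = (∏ i ∈ R with σ (σ i) ≠ i, A i (σ i)) *
      ∏ i ∈ R with i ≤ σ i ∧ σ (σ i) = i,
        (if σ i = i then A i i else A i (σ i) * A (σ i) i - t) := by
  have h1 : (∏ i ∈ R with σ (σ i) ≠ i, A i (σ i)) *
      (∏ i ∈ R with i ≤ σ i ∧ σ (σ i) = i,
        (if σ i = i then A i i else A i (σ i) * A (σ i) i - t)) =
      ∏ i ∈ R with σ (σ i) ≠ i ∨ i ≤ σ i, (if σ (σ i) ≠ i then A i (σ i) else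
        if σ i = i then A i i else A i (σ i) * A (σ i) i - t) := by
    rw [Finset.prod_filter, Finset.prod_filter, Finset.prod_filter, ← Finset.prod_mul_distrib]
    refine Finset.prod_congr rfl fun i _ => ?_
    by_cases h3 : σ (σ i) = i <;> by_cases h4 : i ≤ σ i <;> simp [h3, h4]
  rw [h1, wickProd]
  symm
  -- Each `i` goes to the unit containing the edge `(i, σ i)`. Distinct indices share a unit only
  -- when they form a 2-cycle, of which just the smaller point is kept; units not reached contain no
  -- edge and contribute `1`.
  refine Finset.prod_of_injOn (fun i => (min i (σ i), max i (σ i))) ?_ (by simp) ?_ ?_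
  · intro i hi j hj hij
    simp only [Finset.coe_filter, Set.mem_ofPred_eq, Prod.mk.injEq] at hi hj hij
    by_contra hne
    have h5 : i = σ j ∧ σ i = j := by
      rcases le_total i (σ i) with h | h <;> rcases le_total j (σ j) with h' | h' <;>
        simp only [h, h', min_eq_left, min_eq_right, max_eq_left, max_eq_right] at hij <;> grind
    obtain ⟨h5, h6⟩ := h5
    have h7 : σ (σ i) = i := by rw [h6, ← h5]
    have h8 : σ (σ j) = j := by rw [← h5, h6]
    have h9 : i ≤ σ i := hi.2.resolve_left (fun h => h h7)
    have h10 : j ≤ σ j := hj.2.resolve_left (fun h => h h8)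
    exact hne (le_antisymm (h6 ▸ h9) (h5 ▸ h10))
  · rintro ⟨i, j⟩ - he
    simp only [Set.mem_image, Finset.coe_filter, Set.mem_ofPred_eq, not_exists, not_and,
      Prod.mk.injEq] at he
    have key : i ≤ j → permGraph σ R (i, j) = false ∧ permGraph σ R (j, i) = false := by
      intro hij
      simp only [permGraph, decide_eq_false_iff_not, not_and]
      refine ⟨fun hi h => ?_, fun hj h => ?_⟩
      · exact he i ⟨hi, Or.inr (h ▸ hij)⟩ (by simp [h, hij]) (by simp [h, hij])
      · by_cases h7 : σ (σ j) = j
        · rw [h] at h7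
          exact he i ⟨h ▸ (hR j).2 hj, Or.inr (h7 ▸ hij)⟩ (by simp [h7, hij]) (by simp [h7, hij])
        · exact he j ⟨hj, Or.inl h7⟩ (by simp [h, hij]) (by simp [h, hij])
    unfold unitFactor
    dsimp only
    split_ifs with h1 h2
    · subst h1
      simp [diagFactor, (key le_rfl).1]
    · simp [key h2.le, pairFactor]
    · rfl
  · intro i hi
    rw [Finset.mem_filter] at hi
    obtain ⟨hi, h⟩ := hi
    have hσi := (hR i).2 hi
    rcases lt_trichotomy i (σ i) with h1 | h1 | h1
    · have h2 : permGraph σ R (i, σ i) = true := by simp [permGraph, hi]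
      by_cases h3 : σ (σ i) = i
      · have h4 : permGraph σ R (σ i, i) = true := by simp [permGraph, hσi, h3]
        simp [unitFactor, h1.le, h1.ne, h1, h2, h3, h4, pairFactor, h1.ne']
      · have h4 : permGraph σ R (σ i, i) = false := by simp [permGraph, h3]
        simp [unitFactor, h1.le, h1.ne, h1, h2, h3, h4, pairFactor]
    · have h2 : permGraph σ R (i, i) = true := by simp [permGraph, hi, ← h1]
      simp [unitFactor, ← h1, h2, diagFactor]
    · have h3 : σ (σ i) ≠ i := h.resolve_right h1.not_ge
      have h2 : permGraph σ R (i, σ i) = true := by simp [permGraph, hi]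
      have h4 : permGraph σ R (σ i, i) = false := by simp [permGraph, h3]
      simp [unitFactor, h1.le, h1.ne, h1, h2, h3, h4, pairFactor]

/-- A permutation preserves `R` and squares to the identity outside `R`. -/
def IsInvolutiveOff {n : ℕ} (σ : Equiv.Perm (Fin n)) (R : Finset (Fin n)) : Prop :=
  (∀ i, σ i ∈ R ↔ i ∈ R) ∧ ∀ i, i ∉ R → σ (σ i) = i

theorem IsInvolutiveOff.prod_compl_mul_wickProd {n : ℕ} {t : ℝ} {r w : ℂ} (hr : r ^ 2 = t)
    {σ : Equiv.Perm (Fin n)} {R : Finset (Fin n)} (hR : IsInvolutiveOff σ R)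
    (A : Matrix (Fin n) (Fin n) ℂ) :
    (∏ i ∈ Rᶜ, if σ i = i then w else r) * ((-1) ^ R.card * wickProd t (permGraph σ R) A) =
      (∏ i with σ (σ i) ≠ i, ((if σ i = i then w else 0) - A i (σ i))) *
        ((∏ i ∈ R with i ≤ σ i ∧ σ (σ i) = i,
          (if σ i = i then -A i i else A i (σ i) * A (σ i) i - t)) *
          ∏ i ∈ (Finset.univ.filter fun i => i ≤ σ i ∧ σ (σ i) = i) \
            R.filter fun i => i ≤ σ i ∧ σ (σ i) = i, (if σ i = i then w else t)) := by
  obtain ⟨hR1, hR2⟩ := hR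
  have e1 : Finset.univ.filter (fun i => σ (σ i) ≠ i) = R.filter fun i => σ (σ i) ≠ i := by
    ext i
    simp only [Finset.mem_filter, Finset.mem_univ, true_and]
    exact ⟨fun h => ⟨by_contra fun h' => h (hR2 i h'), h⟩, fun h => h.2⟩
  have e2 : Rᶜ.filter (fun i => σ (σ i) ≠ i) = ∅ := by
    ext i
    simp only [Finset.mem_filter, Finset.mem_compl, Finset.notMem_empty, iff_false, not_and,
      not_not]
    exact hR2 i
  have e3 : (Finset.univ.filter fun i => i ≤ σ i ∧ σ (σ i) = i) \
      R.filter (fun i => i ≤ σ i ∧ σ (σ i) = i) =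
      Rᶜ.filter fun i => i ≤ σ i ∧ σ (σ i) = i := by
    ext i
    simp only [Finset.mem_filter, Finset.mem_univ, true_and, Finset.mem_sdiff, Finset.mem_compl]
    tauto
  have e4 : (-1 : ℂ) ^ R.card = ∏ i ∈ R, -1 := by simp
  rw [e1, e3, e4, prod_eq_prod_mul_prod_two_cycles σ Rᶜ
      (by simpa using fun i => not_congr (hR1 i)),
    e2, Finset.prod_empty, one_mul, prod_eq_prod_mul_prod_two_cycles σ R hR1,
    wickProd_permGraph t σ R hR1]
  have e5 : ∏ i ∈ R with σ (σ i) ≠ i, ((if σ i = i then w else 0) - A i (σ i)) =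
      (∏ i ∈ R with σ (σ i) ≠ i, (-1)) * ∏ i ∈ R with σ (σ i) ≠ i, A i (σ i) := by
    rw [← Finset.prod_mul_distrib]
    refine Finset.prod_congr rfl fun i hi => ?_
    have h : σ i ≠ i := fun h => (Finset.mem_filter.1 hi).2 (by rw [h, h])
    simp [h]
  have e6 : ∏ i ∈ R with i ≤ σ i ∧ σ (σ i) = i,
        (if σ i = i then -A i i else A i (σ i) * A (σ i) i - t) =
      (∏ i ∈ R with i ≤ σ i ∧ σ (σ i) = i, (if σ i = i then (-1) else (-1) * (-1))) *
      ∏ i ∈ R with i ≤ σ i ∧ σ (σ i) = i,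
        (if σ i = i then A i i else A i (σ i) * A (σ i) i - t) := by
    rw [← Finset.prod_mul_distrib]
    refine Finset.prod_congr rfl fun i hi => ?_
    split_ifs <;> ring
  have e7 : ∏ i ∈ Rᶜ with i ≤ σ i ∧ σ (σ i) = i, (if σ i = i then w else (t : ℂ)) =
      ∏ i ∈ Rᶜ with i ≤ σ i ∧ σ (σ i) = i, (if σ i = i then (if σ i = i then w else r) else
        (if σ i = i then w else r) * if σ (σ i) = σ i then w else r) := by
    refine Finset.prod_congr rfl fun i hi => ?_
    by_cases h : σ i = i
    · simp [h]
    · simp [h, ← hr, pow_two]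
  rw [e5, e6, e7]
  ring

-- Longer cycles always lie in `R`; each fixed point or 2-cycle is in `R` when its Wick term is
-- chosen and outside when its scalar is. Weight `r` per point gives a discarded 2-cycle the
-- required `r ^ 2 = t`.
open scoped Classical in
theorem prod_sub_eq_sum_wickProd {n : ℕ} (t : ℝ) (r w : ℂ) (hr : r ^ 2 = t)
    (σ : Equiv.Perm (Fin n)) (A : Matrix (Fin n) (Fin n) ℂ) :
    ∏ i, ((if σ i = i then w else 0) - A i (σ i)) =
      ∑ R with IsInvolutiveOff σ R, (∏ i ∈ Rᶜ, if σ i = i then w else r) *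
        ((-1) ^ R.card * wickProd t (permGraph σ R) A) := by
  rw [prod_eq_prod_mul_prod_two_cycles σ Finset.univ (by simp)]
  have h1 : ∀ i : Fin n, i ≤ σ i ∧ σ (σ i) = i →
      (if σ i = i then (if σ i = i then w else 0) - A i (σ i) else
        ((if σ i = i then w else 0) - A i (σ i)) *
          ((if σ (σ i) = σ i then w else 0) - A (σ i) (σ (σ i)))) =
      (if σ i = i then -A i i else A i (σ i) * A (σ i) i - t) + (if σ i = i then w else t) := by
    rintro i ⟨-, h⟩
    by_cases hi : σ i = i
    · simp [hi]
      ring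
    · simp [hi, h, Ne.symm hi]
  rw [Finset.prod_congr rfl (g := fun i => (if σ i = i then -A i i else
      A i (σ i) * A (σ i) i - t) + (if σ i = i then w else t)) fun i hi =>
      h1 i (Finset.mem_filter.1 hi).2, Finset.prod_add, Finset.mul_sum]
  symm
  -- `Finset.prod_add` sums over sets `T` of least points of cycles of length at most two. `R` is
  -- recovered by completing these cycles and adding all longer ones.
  refine Finset.sum_nbij'
    (fun R => R.filter fun i => i ≤ σ i ∧ σ (σ i) = i)
    (fun T => Finset.univ.filter fun i => σ (σ i) ≠ i ∨ i ∈ T ∨ σ i ∈ T) ?_ ?_ ?_ ?_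
    fun R hR => (Finset.mem_filter.1 hR).2.prod_compl_mul_wickProd hr A
  · intro R hR
    rw [Finset.mem_powerset]
    exact Finset.filter_subset_filter _ (Finset.subset_univ _)
  · intro T hT
    rw [Finset.mem_powerset] at hT
    have hT' : ∀ i ∈ T, i ≤ σ i ∧ σ (σ i) = i := fun i hi => by simpa using hT hi
    refine Finset.mem_filter.2 ⟨Finset.mem_univ _, fun i => ?_, fun i hi => ?_⟩
    · by_cases h : σ (σ i) = i
      · simp [h]; tauto
      · simp [h]
    · by_contra h
      exact hi (by simp [h])
  · intro R hR
    obtain ⟨hR1, hR2⟩ := (Finset.mem_filter.1 hR).2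
    ext i
    simp only [Finset.mem_filter, Finset.mem_univ, true_and, hR1]
    constructor
    · rintro (h | h | h)
      · by_contra h'
        exact h (hR2 i h')
      · exact h.1
      · exact h.1
    · intro h
      by_cases h2 : σ (σ i) = i
      · rcases le_total i (σ i) with h3 | h3
        · exact Or.inr (Or.inl ⟨h, h3, h2⟩)
        · exact Or.inr (Or.inr ⟨h, by rwa [h2], by rw [h2]⟩)
      · exact Or.inl h2
  · intro T hT
    rw [Finset.mem_powerset] at hT
    have hT' : ∀ i ∈ T, i ≤ σ i ∧ σ (σ i) = i := fun i hi => by simpa using hT hi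
    ext i
    simp only [Finset.mem_filter, Finset.mem_univ, true_and]
    constructor
    · rintro ⟨h | h | h, h1, h2⟩
      · exact absurd h2 h
      · exact h
      · have := (hT' _ h).1
        rw [h2] at this
        rwa [le_antisymm h1 this]
    · intro h
      exact ⟨Or.inr (Or.inl h), hT' i h⟩

/-! ### Involutions and Hermite polynomials -/

/-- The signed generating function of the involutions of `α`, with weight `w` for each fixed point
and `r` for every other point. -/
noncomputable def involutionSum (α : Type*) [Fintype α] [DecidableEq α] (r w : ℂ) : ℂ :=
  ∑ τ : Equiv.Perm α with τ * τ = 1,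
    ((Equiv.Perm.sign τ : ℤ) : ℂ) * ∏ i, if τ i = i then w else r

theorem mul_self_eq_one_iff_cycleType {α : Type*} [Fintype α] [DecidableEq α]
    (τ : Equiv.Perm α) :
    τ * τ = 1 ↔ τ.cycleType = Multiset.replicate (Multiset.card τ.cycleType) 2 := by
  rw [← pow_two, Multiset.eq_replicate_card]
  constructor
  · intro h b hb
    have h1 := (Equiv.Perm.dvd_of_mem_cycleType hb).trans (orderOf_dvd_of_pow_eq_one h)
    have h2 := Equiv.Perm.two_le_of_mem_cycleType hb
    exact le_antisymm (Nat.le_of_dvd two_pos h1) h2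
  · intro h
    rw [← orderOf_dvd_iff_pow_eq_one, ← Equiv.Perm.lcm_cycleType, Multiset.lcm_dvd]
    intro b hb
    rw [h b hb]

theorem involution_weight {α : Type*} [Fintype α] [DecidableEq α] (r w : ℂ) (k : ℕ)
    (τ : Equiv.Perm α) (hτ : τ.cycleType = Multiset.replicate k 2) :
    ((Equiv.Perm.sign τ : ℤ) : ℂ) * (∏ i, if τ i = i then w else r) =
      (-1) ^ k * (r ^ (2 * k) * w ^ (Fintype.card α - 2 * k)) := by
  have h1 : τ.support.card = 2 * k := by
    rw [← Equiv.Perm.sum_cycleType, hτ]; simp [mul_comm]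
  have h2 : (Finset.univ.filter fun i => τ i = i).card = Fintype.card α - 2 * k := by
    rw [← h1, ← Finset.card_compl]
    congr 1
    ext i
    simp
  have h3 : (Finset.univ.filter fun i => ¬ τ i = i).card = 2 * k := by
    rw [← h1]
    congr 1
  rw [Finset.prod_ite, Finset.prod_const, Finset.prod_const, h2, h3, Equiv.Perm.sign_of_cycleType,
    hτ]
  simp [pow_add, pow_mul, mul_comm]

theorem card_involutions {α : Type*} [Fintype α] [DecidableEq α] (k : ℕ)
    (hk : 2 * k ≤ Fintype.card α) :
    (Finset.univ.filter fun τ : Equiv.Perm α => τ.cycleType = Multiset.replicate k 2).card *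
      ((Fintype.card α - 2 * k).factorial * 2 ^ k * k.factorial) = (Fintype.card α).factorial := by
  have h := Equiv.Perm.card_of_cycleType_mul_eq α (Multiset.replicate k 2)
  rw [if_pos ⟨by simpa [mul_comm] using hk, fun a ha => by simp [(Multiset.mem_replicate.1 ha).2]⟩]
    at h
  rcases Nat.eq_zero_or_pos k with rfl | hk0
  · simpa using h
  · rw [← h]
    simp [Multiset.toFinset_replicate, hk0.ne', mul_comm k 2]

theorem involutionSum_eq_sum (α : Type*) [Fintype α] [DecidableEq α] (r w : ℂ) :
    involutionSum α r w = ∑ k ∈ Finset.range (Fintype.card α / 2 + 1),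
      ((Fintype.card α).factorial : ℂ) /
        ((Fintype.card α - 2 * k).factorial * 2 ^ k * k.factorial) *
        ((-1) ^ k * (r ^ (2 * k) * w ^ (Fintype.card α - 2 * k))) := by
  rw [involutionSum, ← Finset.sum_fiberwise_of_maps_to
    (g := fun τ : Equiv.Perm α => Multiset.card τ.cycleType)
    (t := Finset.range (Fintype.card α / 2 + 1))]
  · refine Finset.sum_congr rfl fun k hk => ?_
    have hk' : 2 * k ≤ Fintype.card α := by
      have := Finset.mem_range.1 hk
      omega
    have h1 : (Finset.univ.filter fun τ : Equiv.Perm α => τ * τ = 1).filter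
        (fun τ => Multiset.card τ.cycleType = k) =
        Finset.univ.filter fun τ : Equiv.Perm α => τ.cycleType = Multiset.replicate k 2 := by
      ext τ
      simp only [Finset.mem_filter, Finset.mem_univ, true_and, mul_self_eq_one_iff_cycleType]
      constructor
      · rintro ⟨h, rfl⟩; exact h
      · intro h; simp [h]
    rw [h1, Finset.sum_congr rfl fun τ hτ => involution_weight r w k τ (Finset.mem_filter.1 hτ).2,
      Finset.sum_const, nsmul_eq_mul]
    congr 1
    rw [eq_div_iff (by simp [Nat.factorial_ne_zero])]
    exact_mod_cast card_involutions (α := α) k hk'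
  · intro τ hτ
    have h := (mul_self_eq_one_iff_cycleType τ).1 (Finset.mem_filter.1 hτ).2
    have h1 : τ.support.card ≤ Fintype.card α := Finset.card_le_univ _
    rw [← Equiv.Perm.sum_cycleType, h] at h1
    simp only [Multiset.sum_replicate, smul_eq_mul] at h1
    rw [Finset.mem_range]
    omega

theorem aeval_hermite_eq_sum (m : ℕ) (x : ℂ) :
    Polynomial.aeval x (Polynomial.hermite m) = ∑ k ∈ Finset.range (m / 2 + 1),
      (m.factorial : ℂ) / ((m - 2 * k).factorial * 2 ^ k * k.factorial) *
        ((-1) ^ k * x ^ (m - 2 * k)) := by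
  rw [Polynomial.aeval_eq_sum_range, Polynomial.natDegree_hermite]
  symm
  refine Finset.sum_of_injOn (fun k => m - 2 * k) ?_ ?_ ?_ ?_
  · intro a ha b hb hab
    simp only [Finset.coe_range, Set.mem_Iio] at ha hb hab
    omega
  · intro a ha
    simp only [Finset.coe_range, Set.mem_Iio] at ha ⊢
    omega
  -- Degrees missed by `k ↦ m - 2 * k` have the wrong parity, where Hermite coefficients vanish.
  · intro j hj hj'
    rw [Finset.mem_range] at hj
    have : Odd (m + j) := by
      by_contra h
      rw [Nat.not_odd_iff_even] at h
      obtain ⟨l, hl⟩ := h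
      refine hj' ⟨(m - j) / 2, ?_, ?_⟩
      · simp only [Finset.coe_range, Set.mem_Iio]; omega
      · dsimp only; omega
    rw [Polynomial.coeff_hermite_of_odd_add this, zero_smul]
  · intro k hk
    have hk := Finset.mem_range.1 hk
    obtain ⟨j, rfl⟩ : ∃ j, m = 2 * k + j := ⟨m - 2 * k, by omega⟩
    rw [Nat.add_sub_cancel_left, Polynomial.coeff_hermite_explicit, zsmul_eq_mul,
      mul_comm _ ((-1) ^ k * x ^ j)]
    push_cast
    have h1 : ((2 * k - 1).doubleFactorial : ℂ) * (2 ^ k * k.factorial) = (2 * k).factorial := by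
      cases k with
      | zero => simp
      | succ l =>
        have h := Nat.factorial_eq_mul_doubleFactorial (2 * l + 1)
        rw [show 2 * l + 1 + 1 = 2 * (l + 1) by ring, Nat.doubleFactorial_two_mul] at h
        rw [show 2 * (l + 1) - 1 = 2 * l + 1 by omega, h]
        push_cast
        ring
    have h2 : ((2 * k + j).choose j : ℂ) * (j.factorial * (2 * k).factorial) =
        (2 * k + j).factorial := by
      have := Nat.choose_mul_factorial_mul_factorial (Nat.le_add_left j (2 * k))
      rw [Nat.add_sub_cancel] at this
      rw [← mul_assoc]
      exact_mod_cast this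
    rw [← h2, ← h1]
    have : (k.factorial : ℂ) ≠ 0 := by exact_mod_cast k.factorial_ne_zero
    have : (j.factorial : ℂ) ≠ 0 := by exact_mod_cast j.factorial_ne_zero
    field_simp

/-- Involutions are matchings of the complete graph, with sign `(-1) ^ k` for `k` edges; this is the
matching expansion of the Hermite polynomial, rescaled by `r`. -/
theorem involutionSum_eq_hermite (α : Type*) [Fintype α] [DecidableEq α] {r : ℂ} (hr : r ≠ 0)
    (w : ℂ) :
    involutionSum α r w = r ^ Fintype.card α *
      Polynomial.aeval (w / r) (Polynomial.hermite (Fintype.card α)) := by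
  rw [involutionSum_eq_sum, aeval_hermite_eq_sum, Finset.mul_sum]
  refine Finset.sum_congr rfl fun k hk => ?_
  have hk := Finset.mem_range.1 hk
  have : r ^ Fintype.card α = r ^ (2 * k) * r ^ (Fintype.card α - 2 * k) := by
    rw [← pow_add]; congr 1; omega
  rw [this, div_pow]
  field_simp

/-! ### Expansion of the determinant -/

/-- The edges `(i, π i)` of a permutation `π` of the subset `R`. -/
noncomputable def subsetPermGraph {n : ℕ}
    (x : (R : Finset (Fin n)) × Equiv.Perm {i // i ∈ R}) (e : Fin n × Fin n) : Bool :=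
  decide (∃ h : e.1 ∈ x.1, (x.2 ⟨e.1, h⟩ : Fin n) = e.2)

/-- The sources of the edges recover `R` and their targets recover `π`. Hence distinct indices in
the determinant expansion have orthogonal Wick products. -/
theorem subsetPermGraph_injective {n : ℕ} : Function.Injective (subsetPermGraph (n := n)) := by
  have key : ∀ x y : (R : Finset (Fin n)) × Equiv.Perm {i // i ∈ R},
      subsetPermGraph x = subsetPermGraph y → ∀ i (h : i ∈ x.1),
        ∃ h' : i ∈ y.1, (y.2 ⟨i, h'⟩ : Fin n) = x.2 ⟨i, h⟩ := by
    intro x y hxy i h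
    have h1 := congrFun hxy (i, x.2 ⟨i, h⟩)
    simp only [subsetPermGraph, decide_eq_decide] at h1
    exact h1.1 ⟨h, by simp⟩
  rintro ⟨R, π⟩ ⟨S, ρ⟩ h
  have hRS : R = S := by
    ext i
    exact ⟨fun hi => (key _ _ h i hi).1, fun hi => (key _ _ h.symm i hi).1⟩
  subst hRS
  congr 1
  ext ⟨i, hi⟩
  exact (key _ _ h i hi).2.symm ▸ rfl

/-- The coefficients of `det (w - A)` in the Wick products. -/
noncomputable def detCoeff {n : ℕ} (r w : ℂ)
    (x : (R : Finset (Fin n)) × Equiv.Perm {i // i ∈ R}) : ℂ :=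
  (-1) ^ x.1.card * ((Equiv.Perm.sign x.2 : ℤ) : ℂ) * involutionSum {i // i ∉ x.1} r w

theorem detCoeff_mk {n : ℕ} (r w : ℂ) (R : Finset (Fin n)) (π : Equiv.Perm {i // i ∈ R}) :
    detCoeff r w ⟨R, π⟩ = (-1) ^ R.card * ((Equiv.Perm.sign π : ℤ) : ℂ) *
      ∑ τ : Equiv.Perm {i // i ∉ R} with τ * τ = 1,
        ((Equiv.Perm.sign τ : ℤ) : ℂ) * ∏ i, if τ i = i then w else r :=
  rfl

theorem sign_subtypeCongr_mem {n : ℕ} (R : Finset (Fin n)) (π : Equiv.Perm {i // i ∈ R})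
    (τ : Equiv.Perm {i // i ∉ R}) :
    ((Equiv.Perm.sign (π.subtypeCongr τ) : ℤ) : ℂ) =
      ((Equiv.Perm.sign π : ℤ) : ℂ) * ((Equiv.Perm.sign τ : ℤ) : ℂ) := by
  rw [Equiv.Perm.sign_subtypeCongr]
  push_cast
  congr!

theorem isInvolutiveOff_subtypeCongr {n : ℕ} {R : Finset (Fin n)}
    (π : Equiv.Perm {i // i ∈ R}) {τ : Equiv.Perm {i // i ∉ R}} (hτ : τ * τ = 1) :
    IsInvolutiveOff (π.subtypeCongr τ) R := by
  refine ⟨fun i => ?_, fun i hi => ?_⟩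
  · by_cases hi : i ∈ R
    · simp [Equiv.Perm.subtypeCongr.left_apply π τ hi, hi]
    · simpa [Equiv.Perm.subtypeCongr.right_apply π τ hi, hi] using (τ ⟨i, hi⟩).2
  · rw [Equiv.Perm.subtypeCongr.right_apply π τ hi,
      Equiv.Perm.subtypeCongr.right_apply π τ (τ ⟨i, hi⟩).2]
    have := congrArg Subtype.val (Equiv.congr_fun hτ ⟨i, hi⟩)
    simpa using this

-- Such a `σ` is a permutation of `R` glued to an involution of the complement. Its Wick product
-- depends only on the first part, so the second can be summed out.
open scoped Classical in
theorem sum_isInvolutiveOff {n : ℕ} (R : Finset (Fin n)) (f : Equiv.Perm (Fin n) → ℂ) :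
    ∑ σ with IsInvolutiveOff σ R, f σ =
      ∑ π : Equiv.Perm {i // i ∈ R}, ∑ τ : Equiv.Perm {i // i ∉ R} with τ * τ = 1,
        f (π.subtypeCongr τ) := by
  rw [← Finset.sum_product']
  symm
  refine Finset.sum_nbij (fun x => x.1.subtypeCongr x.2) ?_ ?_ ?_ (fun _ _ => rfl)
  · rintro ⟨π, τ⟩ h
    simp only [Finset.mem_product, Finset.mem_filter, Finset.mem_univ, true_and] at h
    exact Finset.mem_filter.2 ⟨Finset.mem_univ _, isInvolutiveOff_subtypeCongr π h⟩
  · rintro ⟨π, τ⟩ - ⟨π', τ'⟩ - h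
    have h1 : π = π' := Equiv.ext fun i => Subtype.ext <| by
      have := Equiv.congr_fun h i
      simp only [Equiv.Perm.subtypeCongr.left_apply_subtype] at this
      exact this
    have h2 : τ = τ' := Equiv.ext fun i => Subtype.ext <| by
      have := Equiv.congr_fun h i
      simp only [Equiv.Perm.subtypeCongr.right_apply_subtype] at this
      exact this
    rw [h1, h2]
  · intro σ hσ
    obtain ⟨h1, h2⟩ := (Finset.mem_filter.1 hσ).2
    refine ⟨(σ.subtypePerm h1, σ.subtypePerm fun i => not_congr (h1 i)), ?_, ?_⟩
    · simp only [Finset.coe_product, Set.mem_prod, Finset.mem_coe, Finset.mem_filter,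
        Finset.mem_univ, true_and]
      ext i
      exact congrArg Fin.val (h2 i i.2)
    · ext i
      by_cases hi : i ∈ R
      · simp [Equiv.Perm.subtypeCongr.left_apply _ _ hi]
      · simp [Equiv.Perm.subtypeCongr.right_apply _ _ hi]

theorem permGraph_subtypeCongr {n : ℕ} (R : Finset (Fin n)) (π : Equiv.Perm {i // i ∈ R})
    (τ : Equiv.Perm {i // i ∉ R}) :
    permGraph (π.subtypeCongr τ) R = subsetPermGraph ⟨R, π⟩ := by
  funext e
  simp only [permGraph, subsetPermGraph, decide_eq_decide]
  constructor
  · rintro ⟨h, h'⟩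
    exact ⟨h, by rwa [Equiv.Perm.subtypeCongr.left_apply _ _ h] at h'⟩
  · rintro ⟨h, h'⟩
    exact ⟨h, by rwa [Equiv.Perm.subtypeCongr.left_apply _ _ h]⟩

theorem prod_compl_subtypeCongr {n : ℕ} (r w : ℂ) (R : Finset (Fin n))
    (π : Equiv.Perm {i // i ∈ R}) (τ : Equiv.Perm {i // i ∉ R}) :
    (∏ i ∈ Rᶜ, if π.subtypeCongr τ i = i then w else r) = ∏ i, if τ i = i then w else r := by
  rw [Finset.prod_subtype (p := fun i => i ∉ R) Rᶜ (by simp)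
    (fun i => if π.subtypeCongr τ i = i then w else r)]
  refine Finset.prod_congr rfl fun i _ => ?_
  simp only [Equiv.Perm.subtypeCongr.right_apply_subtype, Subtype.ext_iff]

/-- The expansion of `det (w - A)` in the orthonormal Wick products. -/
theorem det_sub_eq_sum_wickProd {n : ℕ} (t : ℝ) (r w : ℂ) (hr : r ^ 2 = t)
    (A : Matrix (Fin n) (Fin n) ℂ) :
    (w • (1 : Matrix (Fin n) (Fin n) ℂ) - A).det =
      ∑ x, detCoeff r w x * wickProd t (subsetPermGraph x) A := by
  classical
  -- Transposing puts the Leibniz factors in the form `A i (σ i)`, matching the edges `(i, σ i)`.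
  rw [← Matrix.det_transpose, Matrix.det_apply', Fintype.sum_sigma]
  have h1 : ∀ σ : Equiv.Perm (Fin n),
      ∏ i, (w • (1 : Matrix (Fin n) (Fin n) ℂ) - A).transpose (σ i) i =
      ∏ i, ((if σ i = i then w else 0) - A i (σ i)) := fun σ => by
    refine Finset.prod_congr rfl fun i _ => ?_
    simp [Matrix.one_apply, eq_comm]
  simp only [h1, prod_sub_eq_sum_wickProd t r w hr, Finset.mul_sum]
  simp only [Finset.sum_filter]
  rw [Finset.sum_comm]
  simp only [← Finset.sum_filter]
  refine Finset.sum_congr rfl fun R _ => ?_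
  rw [sum_isInvolutiveOff]
  refine Finset.sum_congr rfl fun π _ => ?_
  simp only [detCoeff_mk, Finset.mul_sum, Finset.sum_mul, permGraph_subtypeCongr,
    prod_compl_subtypeCongr, sign_subtypeCongr_mem]
  refine Finset.sum_congr rfl fun τ _ => ?_
  ring

/-! ### Parseval and the second moment -/

/-- Parseval's identity for a finite orthonormal family of functions. -/
theorem integral_norm_sq_sum_of_orthonormal {Ω I : Type*} [MeasurableSpace Ω] [Fintype I]
    [DecidableEq I] (μ : Measure Ω) (W : I → Ω → ℂ) (c : I → ℂ)
    (hint : ∀ x y, Integrable (fun ω => W x ω * conj (W y ω)) μ)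
    (hort : ∀ x y, ∫ ω, W x ω * conj (W y ω) ∂μ = if x = y then 1 else 0) :
    Integrable (fun ω => ‖∑ x, c x * W x ω‖ ^ 2) μ ∧
      ∫ ω, ‖∑ x, c x * W x ω‖ ^ 2 ∂μ = ∑ x, ‖c x‖ ^ 2 := by
  have h1 : ∀ ω, ((‖∑ x, c x * W x ω‖ ^ 2 : ℝ) : ℂ) =
      ∑ x, ∑ y, c x * conj (c y) * (W x ω * conj (W y ω)) := fun ω => by
    push_cast
    rw [← Complex.mul_conj']
    simp only [map_sum, map_mul, Finset.sum_mul]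
    simp only [Finset.mul_sum]
    exact Finset.sum_congr rfl fun x _ => Finset.sum_congr rfl fun y _ => by ring
  have h2 : ∀ x y, Integrable (fun ω => c x * conj (c y) * (W x ω * conj (W y ω))) μ :=
    fun x y => (hint x y).const_mul _
  have h3 : Integrable (fun ω => ((‖∑ x, c x * W x ω‖ ^ 2 : ℝ) : ℂ)) μ := by
    simp only [h1]
    exact integrable_finsetSum _ fun x _ => integrable_finsetSum _ fun y _ => h2 x y
  refine ⟨h3.re, ?_⟩
  apply Complex.ofReal_injective
  rw [← integral_complex_ofReal]
  simp only [h1]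
  rw [integral_finsetSum _ fun x _ => integrable_finsetSum _ fun y _ => h2 x y]
  simp only [integral_finsetSum _ fun y _ => h2 _ y, integral_const_mul, hort]
  simp [Complex.mul_conj']

theorem norm_detCoeff_sq {n : ℕ} {t : ℝ} (ht : 0 < t) (w : ℂ)
    (x : (R : Finset (Fin n)) × Equiv.Perm {i // i ∈ R}) :
    ‖detCoeff (Real.sqrt t : ℂ) w x‖ ^ 2 = t ^ (n - x.1.card) *
      ‖Polynomial.aeval (w / (Real.sqrt t : ℂ)) (Polynomial.hermite (n - x.1.card))‖ ^ 2 := by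
  have h0 : (Real.sqrt t : ℂ) ≠ 0 := by
    exact_mod_cast (Real.sqrt_pos.2 ht).ne'
  have h1 : Fintype.card {i // i ∉ x.1} = n - x.1.card := by
    simp [Fintype.card_subtype_compl]
  have h2 : ‖((Equiv.Perm.sign x.2 : ℤ) : ℂ)‖ = 1 := by
    rcases Int.units_eq_one_or (Equiv.Perm.sign x.2) with h | h <;> simp [h]
  rw [detCoeff, involutionSum_eq_hermite _ h0, h1]
  simp only [norm_mul, norm_pow, norm_neg, norm_one, one_pow, one_mul, h2, Complex.norm_real,
    Real.norm_eq_abs, abs_of_pos (Real.sqrt_pos.2 ht), mul_pow]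
  rw [← pow_mul, mul_comm _ 2, pow_mul, Real.sq_sqrt ht.le]

theorem sum_norm_detCoeff_sq {n : ℕ} {t : ℝ} (ht : 0 < t) (w : ℂ) :
    ∑ x : (R : Finset (Fin n)) × Equiv.Perm {i // i ∈ R}, ‖detCoeff (Real.sqrt t : ℂ) w x‖ ^ 2 =
      n.factorial * ∑ k ∈ Finset.range (n + 1), t ^ k / (k.factorial : ℝ) *
        ‖Polynomial.aeval (w / (Real.sqrt t : ℂ)) (Polynomial.hermite k)‖ ^ 2 := by
  simp only [norm_detCoeff_sq ht, Fintype.sum_sigma, Finset.sum_const, Finset.card_univ,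
    Fintype.card_perm, Fintype.card_coe]
  -- The summand depends only on `|R|`; reflecting the range makes `k = n - |R|` the index.
  rw [← Finset.powerset_univ, Finset.sum_powerset_apply_card (fun m => m.factorial •
    (t ^ (n - m) *
      ‖Polynomial.aeval (w / (Real.sqrt t : ℂ)) (Polynomial.hermite (n - m))‖ ^ 2)),
    Finset.card_univ, Fintype.card_fin, ← Finset.sum_range_reflect, Finset.mul_sum]
  refine Finset.sum_congr rfl fun k hk => ?_
  have hk : k ≤ n := Nat.lt_succ_iff.1 (Finset.mem_range.1 hk)
  rw [show n + 1 - 1 - k = n - k by omega, show n - (n - k) = k by omega, nsmul_eq_mul,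
    nsmul_eq_mul, Nat.choose_symm hk]
  have h := Nat.choose_mul_factorial_mul_factorial hk
  have hk0 : (k.factorial : ℝ) ≠ 0 := by exact_mod_cast k.factorial_ne_zero
  rw [← h]
  push_cast
  field_simp

/-- The second moment of the characteristic polynomial of the Elliptic Ginibre Ensemble. -/
theorem integral_norm_sq_det {n : ℕ} {t : ℝ} (ht0 : 0 < t) (ht1 : t ≤ 1) (w : ℂ) :
    Integrable (fun A : Matrix (Fin n) (Fin n) ℂ =>
        ‖(w • (1 : Matrix (Fin n) (Fin n) ℂ) - A).det‖ ^ 2)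
        (ellipticGinibreLaw n t) ∧
      ∫ A, ‖(w • (1 : Matrix (Fin n) (Fin n) ℂ) - A).det‖ ^ 2 ∂(ellipticGinibreLaw n t) =
        n.factorial * ∑ k ∈ Finset.range (n + 1), t ^ k / (k.factorial : ℝ) *
          ‖Polynomial.aeval (w / (Real.sqrt t : ℂ)) (Polynomial.hermite k)‖ ^ 2 := by
  classical
  have hr : (Real.sqrt t : ℂ) ^ 2 = t := by
    rw [← Complex.ofReal_pow, Real.sq_sqrt ht0.le]
  rw [← sum_norm_detCoeff_sq ht0]
  simp only [det_sub_eq_sum_wickProd t _ w hr]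
  refine integral_norm_sq_sum_of_orthonormal _ (fun x => wickProd t (subsetPermGraph x)) _
    (fun x y => integrable_wickProd t _ _) fun x y => ?_
  rw [integral_wickProd (by linarith) ht1]
  simp only [subsetPermGraph_injective.eq_iff]

/-- Since `1 + t * z ^ 2 = z * g t z`, the scalar `z / √n` factors out of the matrix and enters the
determinant to the power `n`. -/
theorem norm_normalisedCharpoly_sq {n : ℕ} (hn : 1 ≤ n) (t : ℝ) (A : Matrix (Fin n) (Fin n) ℂ)
    {z : ℂ} (hz0 : z ≠ 0) :
    ‖normalisedCharpoly n t A z‖ ^ 2 =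
      ‖z‖ ^ (2 * n) / (n : ℝ) ^ n * ‖Complex.exp (-((n : ℂ) * (t : ℂ) * z ^ 2))‖ *
        ‖(((Real.sqrt n : ℂ) * g t z) • (1 : Matrix (Fin n) (Fin n) ℂ) - A).det‖ ^ 2 := by
  have hn0 : (0 : ℝ) < n := by exact_mod_cast hn
  have hs : (Real.sqrt n : ℂ) ≠ 0 := by exact_mod_cast (Real.sqrt_pos.2 hn0).ne'
  have h1 : (1 + (t : ℂ) * z ^ 2) • (1 : Matrix (Fin n) (Fin n) ℂ) - (z / (Real.sqrt n : ℂ)) • A =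
      (z / (Real.sqrt n : ℂ)) •
        (((Real.sqrt n : ℂ) * g t z) • (1 : Matrix (Fin n) (Fin n) ℂ) - A) := by
    rw [smul_sub, smul_smul]
    congr 2
    rw [g]
    field_simp
  have h2 : ‖Complex.exp (-((n : ℂ) * (t : ℂ) * z ^ 2) / 2)‖ ^ 2 =
      ‖Complex.exp (-((n : ℂ) * (t : ℂ) * z ^ 2))‖ := by
    rw [← norm_pow, ← Complex.exp_nat_mul]
    congr 2
    push_cast
    ring
  have h3 : (‖z / (Real.sqrt n : ℂ)‖ ^ n) ^ 2 = ‖z‖ ^ (2 * n) / (n : ℝ) ^ n := by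
    rw [norm_div, Complex.norm_real, Real.norm_eq_abs, abs_of_pos (Real.sqrt_pos.2 hn0),
      ← pow_mul, mul_comm n 2, div_pow, pow_mul (Real.sqrt n), Real.sq_sqrt hn0.le]
  rw [normalisedCharpoly, h1, Matrix.det_smul, Fintype.card_fin, norm_mul, norm_mul, norm_pow,
    mul_pow, mul_pow, h2, h3]
  ring

end EllipticGinibre

theorem mainTheorem5 {Ω : Type*} [MeasurableSpace Ω] (P : Measure Ω)
    (n : ℕ) (hn : 1 ≤ n) (t : ℝ) (ht0 : 0 < t) (ht1 : t ≤ 1)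
    (A : Ω → Matrix (Fin n) (Fin n) ℂ)
    (hA : HasLaw A (EllipticGinibre.ellipticGinibreLaw n t) P)
    (z : ℂ) (hz : ‖z‖ < 1) (hz0 : z ≠ 0) :
    Integrable (fun ω => ‖EllipticGinibre.normalisedCharpoly n t (A ω) z‖ ^ 2) P ∧
    ∫ ω, ‖EllipticGinibre.normalisedCharpoly n t (A ω) z‖ ^ 2 ∂P =
      ((n.factorial : ℝ) * ‖z‖ ^ (2 * n) / (n : ℝ) ^ n)
        * ‖Complex.exp (-((n : ℂ) * (t : ℂ) * z ^ 2))‖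
        * ∑ k ∈ Finset.range (n + 1), t ^ k / (k.factorial : ℝ)
            * ‖Polynomial.aeval ((Real.sqrt ((n : ℝ) / t) : ℂ) * EllipticGinibre.g t z)
                (Polynomial.hermite k)‖ ^ 2 := by
  obtain ⟨h1, h2⟩ := EllipticGinibre.integral_norm_sq_det (n := n) ht0 ht1
    ((Real.sqrt n : ℂ) * EllipticGinibre.g t z)
  have h3 : (Real.sqrt n : ℂ) * EllipticGinibre.g t z / (Real.sqrt t : ℂ) =
      (Real.sqrt ((n : ℝ) / t) : ℂ) * EllipticGinibre.g t z := by
    rw [Real.sqrt_div (Nat.cast_nonneg n)]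
    push_cast
    ring
  rw [h3] at h2
  simp only [EllipticGinibre.norm_normalisedCharpoly_sq hn t _ hz0]
  refine ⟨?_, ?_⟩
  · rw [← hA.map_eq] at h1
    exact (h1.comp_aemeasurable hA.aemeasurable).const_mul _
  · rw [integral_const_mul]
    have h4 := h1.aestronglyMeasurable
    rw [← hA.map_eq] at h2 h4
    rw [integral_map hA.aemeasurable h4] at h2
    rw [h2]
    ring
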